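/- Let $\mathfrak c$ denote the cardinality of $\mathbb R$. A function $f\colon\mathbb R\to\mathbb R$ is a Sierpiński–Zygmund function if for every set $Z\subset\mathbb R$ of cardinality $\mathfrak c$ the restriction $f|_Z\colon Z\to\mathbb R$ is not a Borel map. Let $\mathcal L$ be an algebra and $\beta$ a cardinal. A set $A\subset\mathcal L$ is $\beta$-algebrable if there are a (not necessarily unital) subalgebra $\mathcal B\subset A\cup\{0\}$ of $\mathcal L$ and a minimal system of generators $Z$ of $\mathcal B$ with $\operatorname{card}(Z)=\beta$; that is, $\mathcal B$ is the algebra generated by $Z$, and no $z\in Z$ belongs to the algebra generated by $Z\setminus\{z\}$. Assume that at least one of the following holds: * Martin's Axiom: for every nonempty partially ordered set $P$ with the countable chain condition and every family of fewer than $\mathfrak c$ dense subsets of $P$ there is a filter on $P$ that meets every member of the family; * the Continuum Hypothesis: $\mathfrak c=\aleph_1$; * $\mathfrak c^+=2^{\mathfrak c}$. Then the set of Sierpiński–Zygmund functions is $2^{\mathfrak c}$-algebrable, as a subset of the real algebra $\mathbb R^{\mathbb R}$ of all functions $\mathbb R\to\mathbb R$ with pointwise operations. -/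

import Mathlib

open scoped Cardinal

/-- Two conditions `p`, `q` of a forcing order are compatible if they have a common lower bound. -/
def ForcingCompatible {P : Type*} [PartialOrder P] (p q : P) : Prop :=
  ∃ r : P, r ≤ p ∧ r ≤ q

/-- The countable chain condition: every set of pairwise incompatible elements is countable. -/
def CountableChainCondition (P : Type*) [PartialOrder P] : Prop :=
  ∀ A : Set P, A.Pairwise (fun p q => ¬ ForcingCompatible p q) → A.Countable

/-- A subset of a forcing order is dense if below every element there is an element of it. -/
def ForcingDense {P : Type*} [PartialOrder P] (D : Set P) : Prop :=
  ∀ p : P, ∃ q ∈ D, q ≤ p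

/-- Martin's Axiom: for every nonempty partial order with the countable chain condition and every
family of fewer than `𝔠` dense subsets, some filter (nonempty, upward closed, downward directed)
meets every member of the family. -/
def MartinsAxiom : Prop :=
  ∀ (P : Type) [PartialOrder P] [Nonempty P], CountableChainCondition P →
    ∀ 𝒟 : Set (Set P), #𝒟 < 𝔠 → (∀ D ∈ 𝒟, ForcingDense D) →
      ∃ G : Order.PFilter P, ∀ D ∈ 𝒟, ((G : Set P) ∩ D).Nonempty

/-- The Continuum Hypothesis. -/
def ContinuumHypothesis : Prop :=
  (𝔠 : Cardinal.{0}) = ℵ₁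

/-- `Z` is a minimal system of generators of the (not necessarily unital) subalgebra `B`:
it generates `B`, and no element of `Z` lies in the algebra generated by the other ones. -/
def IsMinimalGeneratingSystem (𝕜 : Type*) {L : Type*} [Field 𝕜] [NonUnitalRing L] [Module 𝕜 L]
    [IsScalarTower 𝕜 L L] [SMulCommClass 𝕜 L L] (B : NonUnitalSubalgebra 𝕜 L) (Z : Set L) : Prop :=
  NonUnitalAlgebra.adjoin 𝕜 Z = B ∧ ∀ z ∈ Z, z ∉ NonUnitalAlgebra.adjoin 𝕜 (Z \ {z})

/-- `A` is `β`-algebrable: `A ∪ {0}` contains a (not necessarily unital) subalgebra that has a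
minimal system of generators of cardinality `β`. -/
def IsAlgebrable.{u} (𝕜 : Type*) {L : Type u} [Field 𝕜] [NonUnitalRing L] [Module 𝕜 L]
    [IsScalarTower 𝕜 L L] [SMulCommClass 𝕜 L L] (A : Set L) (β : Cardinal.{u}) : Prop :=
  ∃ B : NonUnitalSubalgebra 𝕜 L, (B : Set L) ⊆ A ∪ {0} ∧
    ∃ Z : Set L, IsMinimalGeneratingSystem 𝕜 B Z ∧ #Z = β

/-- Sierpiński–Zygmund functions: the restriction to any set of cardinality `𝔠` is not Borel
(for the Borel σ-algebra of the subspace). -/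
def IsSierpinskiZygmund (f : ℝ → ℝ) : Prop :=
  ∀ Z : Set ℝ, #Z = 𝔠 → ¬ Measurable (fun z : Z => f z)

/-! Take $2^{\mathfrak c}$ functions $g_\xi\colon\mathfrak c\to\mathfrak c$, any two agreeing at
fewer than $\mathfrak c$ places; the set-theoretic hypothesis is used only to obtain them. Enumerate
the reals as $e(i)$ and index the Borel functions injectively by $\mathfrak c$. For each $i$ pick
reals $t_i(j)$, $j<\mathfrak c$, algebraically independent over the ring $R_i$ generated by the
reals of index at most $i$ and the values at $e(i)$ of the Borel functions of index at most $i$. Put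
$f_\xi(e(i))=t_i(g_\xi(i))$.

Let $p$ be a nonconstant polynomial and $h$ a Borel function. For all but fewer than $\mathfrak c$
indices $i$, the finitely many $g_\xi(i)$ involved are distinct and $R_i$ contains the coefficients
of $p$ and $h(e(i))$, so $p(f)\ne h$ at $e(i)$. Borel maps on subsets of $\mathbb R$ extend to Borel
maps on $\mathbb R$, so $p(f)$ is Sierpiński–Zygmund. As $0$ is not, the $f_\xi$ are algebraically
independent, hence minimal generators of a non-unital algebra of the required kind. -/

open Cardinal Set

/-- A well-ordered type of order type the initial ordinal of the continuum. -/
abbrev ContinuumOrder : Type := (𝔠 : Cardinal.{0}).ord.ToType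

theorem ContinuumOrder.mk_eq : #ContinuumOrder = 𝔠 := mk_ord_toType _

theorem ContinuumOrder.mk_Iic_lt (i : ContinuumOrder) : #(Iic i) < 𝔠 := by
  have h := Cardinal.mk_Iic_lt i (by simp) (by rw [mk_eq]; exact aleph0_le_continuum)
  rwa [mk_eq] at h

/-! ### Almost disjoint families of functions -/

/-- There are `2 ^ 𝔠` functions on a set of size `𝔠`, any two of which agree on fewer than `𝔠`
arguments. -/
def HasAlmostDisjointFunctions : Prop :=
  ∃ (Ξ : Type) (g : Ξ → ContinuumOrder → ContinuumOrder), #Ξ = 2 ^ (𝔠 : Cardinal.{0}) ∧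
    ∀ ξ η, ξ ≠ η → #{i | g ξ i = g η i} < 𝔠

/-- Send $X\subseteq\mathfrak c$ to the function coding its initial segments: only $\mathfrak c$
codes are needed, and once two sets differ at $j$ their codes differ from $j$ on. -/
theorem hasAlmostDisjointFunctions_of_two_power_le
    (h : ∀ κ : Cardinal.{0}, κ < 𝔠 → 2 ^ κ ≤ (𝔠 : Cardinal.{0})) :
    HasAlmostDisjointFunctions := by
  have hT : #(Σ i : ContinuumOrder, Set (Iic i)) ≤ #ContinuumOrder := by
    rw [mk_sigma]
    refine (sum_le_sum _ (fun _ => 𝔠) fun i => ?_).trans ?_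
    · rw [mk_set]
      exact h _ (ContinuumOrder.mk_Iic_lt i)
    · simp
  obtain ⟨φ⟩ := hT
  refine ⟨Set ContinuumOrder, fun X i => φ ⟨i, {j | (j : ContinuumOrder) ∈ X}⟩, ?_, ?_⟩
  · rw [mk_set, ContinuumOrder.mk_eq]
  · intro X Y hXY
    obtain ⟨j, hj⟩ : ∃ j, ¬ (j ∈ X ↔ j ∈ Y) := by
      by_contra! hc
      exact hXY (Set.ext hc)
    refine (mk_le_mk_of_subset fun i hi => ?_).trans_lt (ContinuumOrder.mk_Iic_lt j)
    have hi' := φ.injective hi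
    simp only [Sigma.mk.injEq, heq_eq_eq, true_and] at hi'
    by_contra hij
    have hji : j ≤ i := (not_le.1 hij).le
    exact hj (by simpa using Set.ext_iff.1 hi' ⟨j, hji⟩)

theorem exists_almostDisjoint_of_mk_le (M : Set (ContinuumOrder → ContinuumOrder))
    (hM : #M ≤ 𝔠) :
    ∃ h : ContinuumOrder → ContinuumOrder, ∀ f ∈ M, #{i | h i = f i} < 𝔠 := by
  rw [← ContinuumOrder.mk_eq] at hM
  obtain ⟨k⟩ := hM
  -- Diagonalization: at place $i$ only the functions of index at most $i$ are avoided, so fewer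
  -- than $\mathfrak c$ values are forbidden.
  have key : ∀ i, ∃ y, y ∉ (fun f : M => f.1 i) '' (k ⁻¹' Iic i) := by
    intro i
    by_contra! hc
    have h1 : #((fun f : M => f.1 i) '' (k ⁻¹' Iic i)) < 𝔠 :=
      (mk_image_le.trans (mk_preimage_of_injective _ _ k.injective)).trans_lt
        (ContinuumOrder.mk_Iic_lt i)
    rw [Set.eq_univ_of_forall hc, mk_univ, ContinuumOrder.mk_eq] at h1
    exact h1.false
  choose h hh using key
  refine ⟨h, fun f hf => (mk_le_mk_of_subset fun i hi => ?_).trans_lt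
    (ContinuumOrder.mk_Iic_lt (k ⟨f, hf⟩))⟩
  by_contra hik
  exact hh i ⟨⟨f, hf⟩, show k _ ≤ i from (not_le.1 hik).le, hi.symm⟩

/-- A maximal almost disjoint family has more than $\mathfrak c$ members, since diagonalization
would enlarge a smaller one; so it has at least $\mathfrak c^+=2^{\mathfrak c}$. -/
theorem hasAlmostDisjointFunctions_of_succ_eq
    (h : Order.succ (𝔠 : Cardinal.{0}) = 2 ^ (𝔠 : Cardinal.{0})) :
    HasAlmostDisjointFunctions := by
  obtain ⟨M, hM⟩ := zorn_subset
    {F : Set (ContinuumOrder → ContinuumOrder) |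
      F.Pairwise fun f g => #{i | f i = g i} < 𝔠} (by
    intro c hc hchain
    refine ⟨⋃₀ c, ?_, fun s hs => subset_sUnion_of_mem hs⟩
    exact (pairwise_sUnion hchain.directedOn).2 fun s hs => hc hs)
  have hlt : 𝔠 < #M := by
    by_contra! hle
    obtain ⟨f, hf⟩ := exists_almostDisjoint_of_mk_le M hle
    have hfM : f ∈ M := by
      refine hM.2 (y := insert f M) ?_ (subset_insert f M) (mem_insert f M)
      refine hM.1.insert fun g hg _ => ⟨hf g hg, ?_⟩
      simpa only [eq_comm] using hf g hg
    have := hf f hfM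
    simp at this
  refine ⟨M, fun f => f.1, le_antisymm ?_ (h ▸ Order.succ_le_of_lt hlt), ?_⟩
  · refine (mk_set_le M).trans ?_
    rw [← power_def, ContinuumOrder.mk_eq, power_self_eq aleph0_le_continuum]
  · intro f g hfg
    exact hM.1 f.2 g.2 (Subtype.coe_injective.ne hfg)

theorem two_power_le_continuum_of_continuumHypothesis (h : ContinuumHypothesis)
    (κ : Cardinal.{0}) (hκ : κ < 𝔠) : 2 ^ κ ≤ (𝔠 : Cardinal.{0}) := by
  have h0 : κ ≤ ℵ₀ := by
    rw [ContinuumHypothesis] at h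
    rwa [h, ← succ_aleph0, Order.lt_succ_iff] at hκ
  exact (power_le_power_left two_ne_zero h0).trans two_power_aleph0.le

/-! ### Almost disjoint coding under Martin's Axiom -/

/-- The set of codes of the finite initial segments of a binary sequence. -/
def branchCodes (x : ℕ → Bool) : Set ℕ :=
  range fun n : ℕ => Encodable.encode (List.ofFn fun i : Fin n => x i)

theorem encode_ofFn_inj {x y : ℕ → Bool} {n m : ℕ}
    (h : Encodable.encode (List.ofFn fun i : Fin n => x i) =
      Encodable.encode (List.ofFn fun i : Fin m => y i)) :
    n = m ∧ ∀ k < n, x k = y k := by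
  have h' := Encodable.encode_injective h
  have hnm : n = m := by simpa using congrArg List.length h'
  subst hnm
  exact ⟨rfl, fun k hk => congrFun (List.ofFn_injective h') ⟨k, hk⟩⟩

theorem branchCodes_infinite (x : ℕ → Bool) : (branchCodes x).Infinite :=
  infinite_range_of_injective fun _ _ h => (encode_ofFn_inj h).1

theorem branchCodes_inter_finite {x y : ℕ → Bool} (hxy : x ≠ y) :
    (branchCodes x ∩ branchCodes y).Finite := by
  obtain ⟨k, hk⟩ := Function.ne_iff.1 hxy
  refine ((finite_Iic k).image fun n : ℕ =>
    Encodable.encode (List.ofFn fun i : Fin n => x i)).subset ?_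
  rintro _ ⟨⟨n, rfl⟩, ⟨m, hm⟩⟩
  refine ⟨n, ?_, rfl⟩
  by_contra hn
  exact hk ((encode_ofFn_inj hm.symm).2 k (not_le.1 hn))

/-- Conditions of the almost disjoint coding forcing: a finite approximation `stem` to the coding
set, and a finite set `side` of indices in `S` whose sets must not be met any more. -/
@[ext] structure CodingCondition {α : Type} (A : α → Set ℕ) (S : Set α) where
  stem : Finset ℕ
  side : Finset S

namespace CodingCondition

variable {α : Type} {A : α → Set ℕ} {S : Set α}

instance : PartialOrder (CodingCondition A S) where
  le q p := p.stem ⊆ q.stem ∧ p.side ⊆ q.side ∧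
    ∀ m ∈ q.stem, m ∉ p.stem → ∀ a ∈ p.side, m ∉ A a
  le_refl p := ⟨subset_rfl, subset_rfl, fun _ h h' => absurd h h'⟩
  le_trans r q p hrq hqp := by
    refine ⟨hqp.1.trans hrq.1, hqp.2.1.trans hrq.2.1, fun m hm hmp a ha => ?_⟩
    by_cases hmq : m ∈ q.stem
    · exact hqp.2.2 m hmq hmp a ha
    · exact hrq.2.2 m hm hmq a (hqp.2.1 ha)
  le_antisymm p q hpq hqp :=
    CodingCondition.ext (hqp.1.antisymm hpq.1) (hqp.2.1.antisymm hpq.2.1)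

instance : Nonempty (CodingCondition A S) := ⟨⟨∅, ∅⟩⟩

theorem compatible_of_stem_eq {p q : CodingCondition A S} (h : p.stem = q.stem) :
    ForcingCompatible p q := by
  classical
  refine ⟨⟨p.stem, p.side ∪ q.side⟩, ⟨subset_rfl, Finset.subset_union_left, ?_⟩,
    ⟨h.ge, Finset.subset_union_right, ?_⟩⟩
  · exact fun _ hm hm' => absurd hm hm'
  · exact fun _ hm hm' => absurd (h ▸ hm) hm'

/-- Incompatible conditions have different stems, and there are only countably many stems. -/
theorem countableChainCondition : CountableChainCondition (CodingCondition A S) := by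
  intro 𝒜 h𝒜
  have hinj : InjOn CodingCondition.stem 𝒜 := by
    intro p hp q hq hpq
    by_contra hne
    exact h𝒜 hp hq hne (compatible_of_stem_eq hpq)
  exact (mapsTo_univ _ _).countable_of_injOn hinj countable_univ

theorem dense_side (a : S) : ForcingDense {p : CodingCondition A S | a ∈ p.side} := by
  classical
  intro p
  exact ⟨⟨p.stem, insert a p.side⟩, Finset.mem_insert_self _ _, subset_rfl,
    Finset.subset_insert _ _, fun _ hm hm' => absurd hm hm'⟩

theorem dense_stem (hA : ∀ a, (A a).Infinite) (hAd : ∀ a b, a ≠ b → (A a ∩ A b).Finite)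
    {b : α} (hb : b ∉ S) (n : ℕ) :
    ForcingDense {p : CodingCondition A S | ∃ m ∈ p.stem, n ≤ m ∧ m ∈ A b} := by
  classical
  intro p
  -- The new stem element must avoid this finite set, while `A b` is infinite.
  have hfin : (Iio n ∪ ⋃ a ∈ p.side, A b ∩ A a).Finite := by
    refine (finite_Iio n).union (p.side.finite_toSet.biUnion fun a _ => hAd _ _ ?_)
    rintro rfl
    exact hb a.2
  obtain ⟨m, hmb, hm⟩ := ((hA b).sdiff hfin).nonempty
  simp only [mem_union, mem_Iio, mem_iUnion, not_or, not_lt, not_exists] at hm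
  refine ⟨⟨insert m p.stem, p.side⟩, ⟨m, Finset.mem_insert_self _ _, hm.1, hmb⟩,
    Finset.subset_insert _ _, subset_rfl, fun k hk hkp a ha hka => ?_⟩
  rcases Finset.mem_insert.1 hk with rfl | hk
  · exact hm.2 a ha ⟨hmb, hka⟩
  · exact hkp hk

end CodingCondition

theorem MartinsAxiom.exists_coding (hMA : MartinsAxiom) {α : Type} (hα : #α < 𝔠)
    {A : α → Set ℕ} (hA : ∀ a, (A a).Infinite) (hAd : ∀ a b, a ≠ b → (A a ∩ A b).Finite)
    (S : Set α) : ∃ d : Set ℕ, ∀ a, (d ∩ A a).Finite ↔ a ∈ S := by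
  let 𝒟₁ : Set (Set (CodingCondition A S)) := range fun a : S => {p | a ∈ p.side}
  let 𝒟₂ : Set (Set (CodingCondition A S)) := range fun b : (Sᶜ : Set α) × ℕ =>
    {p | ∃ m ∈ p.stem, b.2 ≤ m ∧ m ∈ A b.1}
  have hcard : #(𝒟₁ ∪ 𝒟₂ : Set (Set (CodingCondition A S))) < 𝔠 := by
    refine (mk_union_le _ _).trans_lt (add_lt_of_lt aleph0_le_continuum ?_ ?_)
    · exact mk_range_le.trans_lt ((mk_set_le S).trans_lt hα)
    · refine mk_range_le.trans_lt ?_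
      rw [mk_prod, lift_id, lift_id]
      exact mul_lt_of_lt aleph0_le_continuum ((mk_set_le _).trans_lt hα)
        (by simpa using aleph0_lt_continuum)
  obtain ⟨G, hG⟩ := hMA (CodingCondition A S) CodingCondition.countableChainCondition
    (𝒟₁ ∪ 𝒟₂) hcard (by
      rintro D (⟨a, rfl⟩ | ⟨b, rfl⟩)
      · exact CodingCondition.dense_side a
      · exact CodingCondition.dense_stem hA hAd b.1.2 b.2)
  -- The generic set is the union of the stems. Once `a` enters a side, no later stem element lies
  -- in `A a`; for `a ∉ S` density puts arbitrarily large elements of `A a` into it.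
  refine ⟨{m | ∃ p ∈ G, m ∈ p.stem}, fun a => ⟨fun hfin => ?_, fun ha => ?_⟩⟩
  · by_contra ha
    refine hfin.not_infinite (infinite_of_not_bddAbove ?_)
    rintro ⟨n, hn⟩
    obtain ⟨p, hpG, m, hm, hnm, hma⟩ := hG _ (Or.inr ⟨(⟨a, ha⟩, n + 1), rfl⟩)
    have := hn ⟨⟨p, hpG, hm⟩, hma⟩
    omega
  · obtain ⟨p, hpG, hp⟩ := hG _ (Or.inl ⟨⟨a, ha⟩, rfl⟩)
    refine p.stem.finite_toSet.subset ?_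
    rintro m ⟨⟨q, hqG, hmq⟩, hma⟩
    obtain ⟨r, -, hrp, hrq⟩ := G.directed p hpG q hqG
    by_contra hmp
    exact hrp.2.2 m (hrq.1 hmq) hmp ⟨a, ha⟩ hp hma

/-- Index an almost disjoint family of branches by $\kappa$ binary sequences: every subset of the
index set is coded by a subset of $\mathbb N$, so $2^\kappa\le 2^{\aleph_0}$. -/
theorem MartinsAxiom.two_power_le_continuum (hMA : MartinsAxiom)
    (κ : Cardinal.{0}) (hκ : κ < 𝔠) : 2 ^ κ ≤ (𝔠 : Cardinal.{0}) := by
  have hle : κ ≤ #(ℕ → Bool) := by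
    rw [← power_def]
    simpa using hκ.le
  obtain ⟨K, rfl⟩ := le_mk_iff_exists_set.1 hle
  have hsurj : Function.Surjective
      fun d : Set ℕ => {a : K | (d ∩ branchCodes a).Finite} := by
    intro S
    obtain ⟨d, hd⟩ := hMA.exists_coding hκ (A := fun a : K => branchCodes a)
      (fun a => branchCodes_infinite a)
      (fun a b hab => branchCodes_inter_finite (Subtype.coe_injective.ne hab)) S
    exact ⟨d, Set.ext hd⟩
  simpa [mk_set] using mk_le_of_surjective hsurj

theorem hasAlmostDisjointFunctions
    (h : MartinsAxiom ∨ ContinuumHypothesis ∨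
      Order.succ (𝔠 : Cardinal.{0}) = 2 ^ (𝔠 : Cardinal.{0})) :
    HasAlmostDisjointFunctions := by
  rcases h with h | h | h
  · exact hasAlmostDisjointFunctions_of_two_power_le h.two_power_le_continuum
  · exact hasAlmostDisjointFunctions_of_two_power_le
      (two_power_le_continuum_of_continuumHypothesis h)
  · exact hasAlmostDisjointFunctions_of_succ_eq h

/-! ### Borel functions and algebraic independence -/

theorem mk_measurable_real_le_continuum : #{h : ℝ → ℝ // Measurable h} ≤ 𝔠 := by
  have hset : #{s : Set ℝ // MeasurableSet s} ≤ 𝔠 := by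
    have h1 := MeasurableSpace.cardinal_measurableSet_le_continuum
      (s := ⋃ a : ℚ, {Iio (a : ℝ)})
      ((countable_iUnion fun a => countable_singleton _).le_aleph0.trans aleph0_le_continuum)
    rwa [← Real.borel_eq_generateFrom_Iio_rat, ← BorelSpace.measurable_eq] at h1
  -- A real function is determined by its preimages of rational rays, and $\mathfrak
  -- c^{\aleph_0}=\mathfrak c$.
  let Φ : {h : ℝ → ℝ // Measurable h} → ℚ → {s : Set ℝ // MeasurableSet s} :=
    fun h q => ⟨h.1 ⁻¹' Iio (q : ℝ), h.2 measurableSet_Iio⟩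
  have hΦ : Function.Injective Φ := by
    intro h h' hh
    have key : ∀ x (q : ℚ), h.1 x < q ↔ h'.1 x < q := fun x q =>
      Set.ext_iff.1 (congrArg Subtype.val (congrFun hh q)) x
    ext x
    rcases lt_trichotomy (h.1 x) (h'.1 x) with hlt | heq | hlt
    · obtain ⟨q, hq, hq'⟩ := exists_rat_btwn hlt
      exact absurd ((key x q).1 hq) hq'.not_gt
    · exact heq
    · obtain ⟨q, hq, hq'⟩ := exists_rat_btwn hlt
      exact absurd ((key x q).2 hq) hq'.not_gt
  refine (mk_le_of_injective hΦ).trans ?_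
  rw [← power_def, mk_eq_aleph0 ℚ]
  exact (power_le_power_right hset).trans continuum_power_aleph0.le

/-- With a transcendence basis smaller than $\mathfrak c$, the reals would be algebraic over a ring
of size below $\mathfrak c$, hence too few. -/
theorem exists_algebraicIndependent_adjoin (S : Set ℝ) (hS : #S < 𝔠) :
    ∃ t : ContinuumOrder → ℝ, AlgebraicIndependent (Algebra.adjoin ℚ S) t := by
  obtain ⟨ι, x, hx⟩ := exists_isTranscendenceBasis' (Algebra.adjoin ℚ S) ℝ
  have hK : #(Algebra.adjoin ℚ S) < 𝔠 := by
    refine (Algebra.cardinalMk_adjoin_le ℚ S).trans_lt ?_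
    simp [hS, aleph0_lt_continuum]
  have hι : #ContinuumOrder ≤ #ι := by
    rw [ContinuumOrder.mk_eq]
    by_contra! hlt
    have halg := hx.isAlgebraic
    have h1 := Algebra.IsAlgebraic.cardinalMk_le_max
      (Algebra.adjoin (Algebra.adjoin ℚ S) (range x)) ℝ
    have h2 := Algebra.cardinalMk_adjoin_le (Algebra.adjoin ℚ S) (range x)
    have h3 : #(range x) < 𝔠 := mk_range_le.trans_lt hlt
    rw [mk_real] at h1
    refine (h1.trans (max_le_max_right _ h2)).not_gt ?_
    simp [hK, h3]
  obtain ⟨φ⟩ := hι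
  exact ⟨x ∘ φ, hx.1.comp φ φ.injective⟩

/-- Only finite unions occur, so $\mathfrak c$ need not be regular. -/
theorem mk_biUnion_finset_lt {α β : Type} {κ : Cardinal.{0}} (hκ : ℵ₀ ≤ κ) (s : Finset α)
    (A : α → Set β) (hA : ∀ a ∈ s, #(A a) < κ) : #(⋃ a ∈ s, A a : Set β) < κ := by
  classical
  induction s using Finset.induction_on with
  | empty => simpa using aleph0_pos.trans_le hκ
  | insert a s _ ih =>
    rw [Finset.set_biUnion_insert]
    exact (mk_union_le _ _).trans_lt (add_lt_of_lt hκ (hA a (Finset.mem_insert_self a s))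
      (ih fun b hb => hA b (Finset.mem_insert_of_mem hb)))

theorem AlgebraicIndependent.aeval_notMem_of_coeffs_subset {R A ι σ : Type*} [CommRing R]
    [CommRing A] [Algebra R A] {t : ι → A} (ht : AlgebraicIndependent R t) {k : σ → ι}
    (hk : Function.Injective k) {p : MvPolynomial σ A}
    (hp : (p.coeffs : Set A) ⊆ range (algebraMap R A)) (hc : ∀ c, p ≠ MvPolynomial.C c) :
    MvPolynomial.aeval (t ∘ k) p ∉ range (algebraMap R A) := by
  rintro ⟨r, hr⟩
  obtain ⟨q, rfl⟩ := MvPolynomial.mem_range_map_iff_coeffs_subset.2 hp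
  rw [MvPolynomial.aeval_map_algebraMap] at hr
  have hq : q = MvPolynomial.C r := by
    apply ht.comp k hk
    rw [← hr]
    simp
  exact hc (algebraMap R A r) (by rw [hq, MvPolynomial.map_C])

theorem HasAlmostDisjointFunctions.exists_algebraicIndependent_mod_measurable
    (H : HasAlmostDisjointFunctions) :
    ∃ (Ξ : Type) (f : Ξ → ℝ → ℝ), #Ξ = 2 ^ (𝔠 : Cardinal.{0}) ∧
      ∀ p : MvPolynomial Ξ ℝ, (∀ c, p ≠ MvPolynomial.C c) → ∀ h : ℝ → ℝ, Measurable h →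
        #{x | MvPolynomial.aeval f p x = h x} < 𝔠 := by
  classical
  obtain ⟨Ξ, g, hΞ, hg⟩ := H
  obtain ⟨e⟩ : Nonempty (ContinuumOrder ≃ ℝ) := by
    rw [← Cardinal.eq, ContinuumOrder.mk_eq, mk_real]
  obtain ⟨b⟩ : Nonempty ({h : ℝ → ℝ // Measurable h} ↪ ContinuumOrder) := by
    rw [← Cardinal.le_def, ContinuumOrder.mk_eq]
    exact mk_measurable_real_le_continuum
  let S : ContinuumOrder → Set ℝ := fun i =>
    (fun h : {h : ℝ → ℝ // Measurable h} => h.1 (e i)) '' (b ⁻¹' Iic i) ∪ e '' Iic i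
  have hS : ∀ i, #(S i) < 𝔠 := fun i =>
    (mk_union_le _ _).trans_lt (add_lt_of_lt aleph0_le_continuum
      ((mk_image_le.trans (mk_preimage_of_injective _ _ b.injective)).trans_lt
        (ContinuumOrder.mk_Iic_lt i))
      (mk_image_le.trans_lt (ContinuumOrder.mk_Iic_lt i)))
  choose t ht using fun i => exists_algebraicIndependent_adjoin (S i) (hS i)
  refine ⟨Ξ, fun ξ x => t (e.symm x) (g ξ (e.symm x)), hΞ, fun p hp h hh => ?_⟩
  obtain ⟨s, q, rfl⟩ := MvPolynomial.exists_finset_rename p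
  have hq : ∀ c, q ≠ MvPolynomial.C c := fun c hc => hp c (by rw [hc, MvPolynomial.rename_C])
  -- Indices where two of the relevant `g` collide, or where some coefficient of `q` or the function
  -- `h` is not yet listed.
  let bad : Set ContinuumOrder := (⋃ a ∈ s.offDiag, {i | g a.1 i = g a.2 i}) ∪
    ((⋃ c ∈ q.coeffs, Iio (e.symm c)) ∪ Iio (b ⟨h, hh⟩))
  have hIio : ∀ i : ContinuumOrder, #(Iio i) < 𝔠 := fun i =>
    (mk_le_mk_of_subset Iio_subset_Iic_self).trans_lt (ContinuumOrder.mk_Iic_lt i)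
  have hbad : #bad < 𝔠 := by
    refine (mk_union_le _ _).trans_lt (add_lt_of_lt aleph0_le_continuum
      (mk_biUnion_finset_lt aleph0_le_continuum _ _ fun a ha =>
        hg _ _ (Finset.mem_offDiag.1 ha).2.2)
      ((mk_union_le _ _).trans_lt (add_lt_of_lt aleph0_le_continuum
        (mk_biUnion_finset_lt aleph0_le_continuum _ _ fun c _ => hIio _) (hIio _))))
  refine (mk_le_mk_of_subset ?_).trans_lt ((mk_image_le (f := e) (s := bad)).trans_lt hbad)
  intro x hx
  refine ⟨e.symm x, ?_, e.apply_symm_apply x⟩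
  by_contra hxb
  simp only [bad, mem_union, mem_iUnion, not_or, not_exists, mem_Iio, not_lt,
    mem_ofPred_eq] at hxb
  obtain ⟨hdist, hcoef, hb⟩ := hxb
  have hinj : Function.Injective fun a : s => g a (e.symm x) := by
    intro a a' haa
    by_contra hne
    exact hdist (a.1, a'.1)
      (Finset.mem_offDiag.2 ⟨a.2, a'.2, Subtype.coe_injective.ne hne⟩) haa
  have hrange : range (algebraMap (Algebra.adjoin ℚ (S (e.symm x))) ℝ) =
      (Algebra.adjoin ℚ (S (e.symm x)) : Set ℝ) := Subtype.range_coe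
  refine (ht (e.symm x)).aeval_notMem_of_coeffs_subset hinj (p := q) ?_ hq ?_
  · intro c hc
    rw [hrange]
    exact Algebra.subset_adjoin (Or.inr ⟨e.symm c, hcoef c hc, e.apply_symm_apply c⟩)
  · rw [hrange]
    refine Algebra.subset_adjoin (Or.inl ⟨⟨h, hh⟩, hb, ?_⟩)
    simp only [e.apply_symm_apply]
    rw [← show _ = h x from hx, MvPolynomial.aeval_rename]
    exact MvPolynomial.comp_aeval_apply _ (Pi.evalAlgHom ℝ (fun _ : ℝ => ℝ) x) q

/-! ### From avoiding Borel functions to algebrability -/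

theorem isSierpinskiZygmund_of_mk_eq_measurable_lt {f : ℝ → ℝ}
    (hf : ∀ h : ℝ → ℝ, Measurable h → #{x | f x = h x} < 𝔠) : IsSierpinskiZygmund f := by
  intro Z hZ hmeas
  -- The subspace σ-algebra is pulled back from $\mathbb R$, so the extension exists for arbitrary
  -- `Z`.
  obtain ⟨h, hh, hfh⟩ := hmeas.exists_eq_measurable_comp (f := ((↑) : Z → ℝ))
  refine (hf h hh).not_ge (hZ ▸ mk_le_mk_of_subset fun z hz => ?_)
  exact congrFun hfh ⟨z, hz⟩

theorem NonUnitalAlgebra.exists_aeval_eq_of_mem_adjoin_image {R A σ : Type*} [Field R] [CommRing A]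
    [Algebra R A] {f : σ → A} {s : Set σ} {a : A}
    (ha : a ∈ NonUnitalAlgebra.adjoin R (f '' s)) :
    ∃ p ∈ MvPolynomial.supported R s, MvPolynomial.constantCoeff p = 0 ∧
      MvPolynomial.aeval f p = a := by
  induction ha using NonUnitalAlgebra.adjoin_induction with
  | mem x hx =>
    obtain ⟨i, hi, rfl⟩ := hx
    exact ⟨MvPolynomial.X i, MvPolynomial.X_mem_supported.2 hi, by simp, by simp⟩
  | zero => exact ⟨0, zero_mem _, by simp, by simp⟩
  | add x y _ _ hx hy =>
    obtain ⟨p, hp, hp0, rfl⟩ := hx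
    obtain ⟨q, hq, hq0, rfl⟩ := hy
    exact ⟨p + q, add_mem hp hq, by simp [hp0, hq0], by simp⟩
  | mul x y _ _ hx hy =>
    obtain ⟨p, hp, hp0, rfl⟩ := hx
    obtain ⟨q, hq, hq0, rfl⟩ := hy
    exact ⟨p * q, mul_mem hp hq, by simp [hp0], by simp⟩
  | smul r x _ hx =>
    obtain ⟨p, hp, hp0, rfl⟩ := hx
    exact ⟨r • p, Subalgebra.smul_mem _ hp r, by simp [hp0], by simp⟩

theorem AlgebraicIndependent.notMem_nonUnitalAdjoin {R A σ : Type*} [Field R]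
    [CommRing A] [Algebra R A] {f : σ → A} (hf : AlgebraicIndependent R f) (i : σ) :
    f i ∉ NonUnitalAlgebra.adjoin R (range f \ {f i}) := by
  intro hi
  have hsub : range f \ {f i} ⊆ f '' {i}ᶜ := by
    rintro _ ⟨⟨j, rfl⟩, hj⟩
    exact ⟨j, fun hji => hj (congrArg f hji), rfl⟩
  obtain ⟨p, hp, -, hpi⟩ :=
    NonUnitalAlgebra.exists_aeval_eq_of_mem_adjoin_image (NonUnitalAlgebra.adjoin_mono hsub hi)
  have hpX : p = MvPolynomial.X i := hf (by rw [hpi, MvPolynomial.aeval_X])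
  rw [hpX, MvPolynomial.X_mem_supported] at hp
  exact hp rfl

theorem isAlgebrable_of_forall_nonconstant {L σ : Type} [CommRing L] [Algebra ℝ L] {A : Set L}
    {f : σ → L} (hA : (0 : L) ∉ A)
    (hf : ∀ p : MvPolynomial σ ℝ, (∀ c, p ≠ MvPolynomial.C c) → MvPolynomial.aeval f p ∈ A)
    [Nontrivial L] : IsAlgebrable ℝ A #σ := by
  have hind : AlgebraicIndependent ℝ f := by
    rw [algebraicIndependent_iff]
    intro p hp
    by_contra hp0
    by_cases hc : ∃ c, p = MvPolynomial.C c
    · obtain ⟨c, rfl⟩ := hc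
      rw [MvPolynomial.aeval_C, map_eq_zero] at hp
      exact hp0 (by rw [hp, map_zero])
    · push Not at hc
      exact hA (hp ▸ hf p hc)
  refine ⟨NonUnitalAlgebra.adjoin ℝ (range f), fun a ha => ?_, range f, ⟨rfl, ?_⟩,
    mk_range_eq f hind.injective⟩
  · rw [← image_univ] at ha
    obtain ⟨p, -, hp0, rfl⟩ := NonUnitalAlgebra.exists_aeval_eq_of_mem_adjoin_image ha
    -- Non-unital generation gives zero constant term, so a constant `p` can only be zero.
    by_cases hc : ∃ c, p = MvPolynomial.C c
    · obtain ⟨c, rfl⟩ := hc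
      rw [MvPolynomial.constantCoeff_C] at hp0
      right
      simp [hp0]
    · push Not at hc
      exact Or.inl (hf p hc)
  · rintro _ ⟨i, rfl⟩
    exact hind.notMem_nonUnitalAdjoin i

theorem not_isSierpinskiZygmund_zero : ¬ IsSierpinskiZygmund 0 := fun h =>
  h univ (by rw [mk_univ, mk_real]) measurable_const

theorem mainTheorem2
    (h : MartinsAxiom ∨ ContinuumHypothesis ∨
      Order.succ (𝔠 : Cardinal.{0}) = 2 ^ (𝔠 : Cardinal.{0})) :
    IsAlgebrable ℝ {f : ℝ → ℝ | IsSierpinskiZygmund f} (2 ^ (𝔠 : Cardinal.{0})) := by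
  obtain ⟨Ξ, f, hΞ, hf⟩ :=
    (hasAlmostDisjointFunctions h).exists_algebraicIndependent_mod_measurable
  rw [← hΞ]
  exact isAlgebrable_of_forall_nonconstant not_isSierpinskiZygmund_zero fun p hp =>
    isSierpinskiZygmund_of_mk_eq_measurable_lt (hf p hp)
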